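/- **Setting.** Let $\mathbb{M}_d$ be a connected compact two-point homogeneous Riemannian manifold of dimension $d$ (whenever $\mathrm{dist}(x,y)=\mathrm{dist}(x',y')$ some isometry maps $x\mapsto x'$, $y\mapsto y'$), $\nu$ its normalized Riemannian measure, and $\{S_{n,j}: 1\le j\le\Gamma(n,d),\ n\in\mathbb{N}_0\}$ an orthonormal basis of $L^2(\mathbb{M}_d,\nu;\mathbb{C})$ of smooth eigenfunctions of the Laplace–Beltrami operator, $n$ indexing the distinct eigenvalues, and $\Gamma(n,d)\geq 1$ being the dimension of the $n$-th eigenspace. Write $\mathcal{S}$ for the Hilbert–Schmidt operators on $L^2(\mathbb{M}_d,\nu;\mathbb{C})$, identified with their kernels in $L^2(\mathbb{M}_d^2,\nu\otimes\nu;\mathbb{C})$ (so that $\|\cdot\|_{\mathcal S}$ is the $L^2$ norm of the kernel), $\|\cdot\|_{1}$ for the nuclear norm, and $(f\otimes g)(x,y)=f(x)g(y)$. Let $X=\{X_t,\ t\in\mathbb{Z}\}$ be a sequence of random elements of $L^2(\mathbb{M}_d,\nu;\mathbb{R})$ with $E\|X_t\|^2<\infty$, $E[X_t]=0$, and covariance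 operators $\mathcal{R}_\tau=E[X_s\otimes X_{s+\tau}]=E[X_{s+\tau}\otimes X_s]$ not depending on $s\in\mathbb{Z}$. Let $\mathcal{F}_\omega$ be its spectral density operator family, $\mathcal{F}_\omega=\frac1{2\pi}\sum_{\tau\in\mathbb Z}e^{-i\omega\tau}\mathcal{R}_\tau$ in the sense of Fourier series: $\omega\mapsto\mathcal{F}_\omega\in\mathcal{S}$ is $2\pi$-periodic, integrable over $[-\pi,\pi]$, and $\mathcal{R}_\tau=\int_{-\pi}^{\pi}e^{i\omega\tau}\mathcal{F}_\omega\,d\omega$ for all $\tau\in\mathbb{Z}$. **Hypotheses.** 1. ($H_1$, long-range dependence.) There are $l_\alpha,L_\alpha\in(0,1/2)$, exponents $\alpha(n)\in[l_\alpha,L_\alpha]$, and functions $M_n:[-\pi,\pi]\to(0,\infty)$, continuous and slowly varying at $0$ in Zygmund's sense (for each $\delta>0$, $x^{\delta}M_n(x)$ is increasing and $x^{-\delta}M_n(x)$ is decreasing for small $x>0$), such that, with convergence in $\|\cdot\|_{\mathcal{S}}$, $$\mathcal{F}_\omega=\sum_{n\ge0}\frac{M_n(\omega)}{|\omega|^{\alpha(n)}}\sum_{j=1}^{\Gamma(n,d)}S_{n,j}\otimes\overline{S_{n,j}}\quad(\omega\in[-\pi,\pi]\setminus\{0\}),\qquad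 \mathcal{M}_\omega=\sum_{n\ge0}M_n(\omega)\sum_{j=1}^{\Gamma(n,d)}S_{n,j}\otimes\overline{S_{n,j}}\quad(\omega\in[-\pi,\pi]),$$ and $\sum_{\tau\in\mathbb{Z}}\big\|\int_{-\pi}^{\pi}e^{i\omega\tau}\mathcal{M}_\omega\,d\omega\big\|_{1}<\infty$. 2. (Fourth-order cumulants.) $E\|X_t\|^4<\infty$ for all $t$; for all $t_1,t_2,t_3\in\mathbb{Z}$ the kernel $\mathrm{cum}(X_{t_1},X_{t_2},X_{t_3},X_0)$ on $\mathbb{M}_d^4$ is invariant under the isometries of $\mathbb{M}_d$; and $\sum_{t_1,t_2,t_3\in\mathbb{Z}}\|\mathrm{cum}(X_{t_1},X_{t_2},X_{t_3},X_0)\|^2_{L^2(\mathbb{M}_d^4)}<\infty$. 3. $\int_{-\pi}^{\pi}\|\mathcal{M}_\omega\|_{1}^2\,|\omega|^{-2L_\alpha}\,d\omega<\infty$. 4. The weight $W:\mathbb{R}\to[0,\infty)$ is even, of bounded variation, square integrable, vanishes for $|x|\ge1$, and $\int_{\mathbb R} W=1$. The bandwidths satisfy $B_T>0$, $B_T\to0$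 and $TB_T\to\infty$ as $T\to\infty$. **Weighted periodogram operator.** For $T\ge2$ put $\widetilde X^{(T)}_\omega=(2\pi T)^{-1/2}\sum_{t=0}^{T-1}X_te^{-i\omega t}$, $\mathcal{P}^{(T)}_\omega=\widetilde X^{(T)}_\omega\otimes\widetilde X^{(T)}_{-\omega}$, $W^{(T)}(x)=\sum_{j\in\mathbb{Z}}B_T^{-1}W\big((x+2\pi j)/B_T\big)$ and $$\widehat{\mathcal{F}}^{(T)}_\omega=\frac{2\pi}{T}\sum_{s=1}^{T-1}W^{(T)}\Big(\omega-\frac{2\pi s}{T}\Big)\mathcal{P}^{(T)}_{2\pi s/T}.$$ **Conclusion.** All the integrals below exist (as Bochner integrals in $\mathcal{S}$) for $T\ge2$, and, as $T\to\infty$, $$\left\|\int_{-\pi}^{\pi}E\Big[\widehat{\mathcal{F}}^{(T)}_\omega-\int_{-\pi}^{\pi}W(\xi)\,\mathcal{F}_{\omega-B_T\xi}\,d\xi\Big]d\omega\right\|_{\mathcal{S}}=\mathcal{O}\big(T^{-1/2}B_T^{-1/2}\big).$$ -/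

import Mathlib

open Set Filter Topology MeasureTheory Bundle
open scoped Real ENNReal Manifold ContDiff

namespace ManifoldFTS

noncomputable section

/-! ### Geometry: two-point homogeneous spaces, Riemannian measure, Laplace–Beltrami operator -/

/-- A metric space is two-point homogeneous if any two pairs of points at the same distance
are exchanged by a global isometry. -/
def IsTwoPointHomogeneous (M : Type*) [MetricSpace M] : Prop :=
  ∀ x y x' y' : M, dist x y = dist x' y' → ∃ g : M ≃ᵢ M, g x = x' ∧ g y = y'

section Riemannian

variable {d : ℕ} {M : Type*} [MetricSpace M] [ChartedSpace (EuclideanSpace ℝ (Fin d)) M]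
  [RiemannianBundle (fun x : M => TangentSpace (𝓡 d) x)]

/-- The `i`-th coordinate vector field `∂_i`, in the preferred chart at `p`, at the point of the
chart domain with coordinates `u`. -/
def coordVector (p : M) (i : Fin d) (u : EuclideanSpace ℝ (Fin d)) :
    TangentSpace (𝓡 d) ((chartAt (EuclideanSpace ℝ (Fin d)) p).symm u) :=
  mfderiv 𝓘(ℝ, EuclideanSpace ℝ (Fin d)) (𝓡 d)
    (chartAt (EuclideanSpace ℝ (Fin d)) p).symm u (EuclideanSpace.single i (1 : ℝ))

/-- The Gram matrix `g_{ij} = ⟨∂_i, ∂_j⟩` of the Riemannian metric in the preferred chart at `p`,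
as a function of the coordinates `u`. -/
def gramMatrix (p : M) (u : EuclideanSpace ℝ (Fin d)) : Matrix (Fin d) (Fin d) ℝ :=
  fun i j => inner ℝ (coordVector p i u) (coordVector p j u)

/-- The Laplace–Beltrami operator on complex-valued functions,
`Δ f = (det g)^{-1/2} ∑_i ∂_i ((det g)^{1/2} ∑_j g^{ij} ∂_j f)`,
computed at `p` in the preferred chart at `p`. -/
def laplaceBeltrami (f : M → ℂ) (p : M) : ℂ :=
  let e := chartAt (EuclideanSpace ℝ (Fin d)) p
  let vol : EuclideanSpace ℝ (Fin d) → ℝ := fun u => Real.sqrt (gramMatrix p u).det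
  ((vol (e p))⁻¹ : ℝ) • ∑ i : Fin d,
    fderiv ℝ (fun u => vol u • ∑ j : Fin d, ((gramMatrix p u)⁻¹ i j) •
      fderiv ℝ (f ∘ e.symm) u (EuclideanSpace.single j (1 : ℝ))) (e p)
      (EuclideanSpace.single i (1 : ℝ))

variable [MeasurableSpace M]

/-- `ν` is a constant multiple of the Riemannian volume: in every preferred chart it has density
`c (det g)^{1/2}` with respect to Lebesgue measure, with the same constant `c`. A *probability*
measure with this property is the normalized Riemannian measure. -/
def IsRiemannianMeasure (d : ℕ) {M : Type*} [MetricSpace M]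
    [ChartedSpace (EuclideanSpace ℝ (Fin d)) M]
    [RiemannianBundle (fun x : M => TangentSpace (𝓡 d) x)] [MeasurableSpace M]
    (ν : Measure M) : Prop :=
  ∃ c : ℝ≥0∞, ∀ (p : M) (A : Set M), MeasurableSet A →
    A ⊆ (chartAt (EuclideanSpace ℝ (Fin d)) p).source →
    ν A = c * ∫⁻ u in (chartAt (EuclideanSpace ℝ (Fin d)) p) '' A,
      ENNReal.ofReal (Real.sqrt (gramMatrix p u).det)

/-- `S = (S_{n,j})` is an orthonormal basis of `L²(M, ν; ℂ)` made of smooth eigenfunctions of the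
Laplace–Beltrami operator, `Δ S_{n,j} = -λ_n S_{n,j}`, sorted by the distinct eigenvalues:
`S_{n,j}`, `j < Γ n`, spans the `n`-th eigenspace, of dimension `Γ n`. -/
structure IsLaplaceEigenbasis (d : ℕ) {M : Type*} [MetricSpace M]
    [ChartedSpace (EuclideanSpace ℝ (Fin d)) M]
    [RiemannianBundle (fun x : M => TangentSpace (𝓡 d) x)] [MeasurableSpace M]
    {ν : Measure M} {Γ : ℕ → ℕ}
    (S : HilbertBasis (Σ n : ℕ, Fin (Γ n)) ℂ (Lp ℂ 2 ν)) (lam : ℕ → ℝ) : Prop where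
  strictMono : StrictMono lam
  mult_pos : ∀ n, 0 < Γ n
  eigen : ∀ (n : ℕ) (j : Fin (Γ n)), ∃ u : M → ℂ,
    ContMDiff (𝓡 d) 𝓘(ℝ, ℂ) ∞ u ∧ (∀ p, laplaceBeltrami (d := d) u p = -(lam n : ℂ) * u p) ∧
      (S ⟨n, j⟩ : Lp ℂ 2 ν) =ᵐ[ν] u

end Riemannian

/-! ### Kernels of Hilbert–Schmidt operators -/

section Kernels

variable {X Y : Type*} [MeasurableSpace X] [MeasurableSpace Y]

theorem memLp_tensor {μ : Measure X} {ν : Measure Y} [SFinite μ] [SFinite ν]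
    (f : Lp ℂ 2 μ) (g : Lp ℂ 2 ν) :
    MemLp (fun p : X × Y => f p.1 * g p.2) 2 (μ.prod ν) := by
  have hf := Lp.memLp f
  have hg := Lp.memLp g
  have hm : AEStronglyMeasurable (fun p : X × Y => f p.1 * g p.2) (μ.prod ν) :=
    hf.1.comp_fst.mul hg.1.comp_snd
  refine (memLp_two_iff_integrable_sq_norm hm).2 ?_
  have h1 := (memLp_two_iff_integrable_sq_norm hf.1).1 hf
  have h2 := (memLp_two_iff_integrable_sq_norm hg.1).1 hg
  refine (h1.mul_prod h2).congr (Eventually.of_forall fun p => ?_)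
  simp [mul_pow]

/-- The tensor product `(f ⊗ g)(x, y) = f(x) g(y)`. -/
def tensor {μ : Measure X} {ν : Measure Y} [SFinite μ] [SFinite ν]
    (f : Lp ℂ 2 μ) (g : Lp ℂ 2 ν) : Lp ℂ 2 (μ.prod ν) :=
  (memLp_tensor f g).toLp _

/-- The space of Hilbert–Schmidt operators on `L²(X, μ; ℂ)` with the Hilbert–Schmidt norm, an
operator being represented by its kernel in `L²(X × X, μ ⊗ μ; ℂ)`. The kernel `K` stands for the
operator `(K f)(x) = ∫ K(x, y) f(y) dμ(y)`; its Hilbert–Schmidt norm is the `L²` norm of `K`. -/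
abbrev HS (μ : Measure X) : Type _ := Lp ℂ 2 (μ.prod μ)

/-- The nuclear (trace) norm of the operator with kernel `K`: the supremum of
`∑_i |⟨K e_i, f_i⟩|` over finite orthonormal systems `(e_i)`, `(f_i)`; here `⟨K e, f⟩` is
the inner product of `K` with the kernel `f(x) conj(e(y))`. It is `∞` if `K` is not nuclear. -/
def nuclearNorm {μ : Measure X} [SFinite μ] (K : HS μ) : ℝ≥0∞ :=
  ⨆ (k : ℕ) (e : Fin k → Lp ℂ 2 μ) (f : Fin k → Lp ℂ 2 μ)
    (_ : Orthonormal ℂ e) (_ : Orthonormal ℂ f),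
    ∑ i, ‖inner ℂ (tensor (f i) (star (e i))) K‖ₑ

/-- The kernel `K` has, in Hilbert–Schmidt norm, the diagonal expansion
`∑_n a_n ∑_j S_{n,j} ⊗ conj S_{n,j}`. -/
def HasDiagonalExpansion {μ : Measure X} [SFinite μ] {Γ : ℕ → ℕ}
    (S : HilbertBasis (Σ n : ℕ, Fin (Γ n)) ℂ (Lp ℂ 2 μ)) (a : ℕ → ℝ) (K : HS μ) : Prop :=
  HasSum (fun n => (a n : ℂ) • ∑ j : Fin (Γ n), tensor (S ⟨n, j⟩) (star (S ⟨n, j⟩))) K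

/-- A real-valued square integrable function regarded as a complex-valued one. -/
def complexify {μ : Measure X} (f : Lp ℝ 2 μ) : Lp ℂ 2 μ :=
  Complex.ofRealCLM.compLp f

end Kernels

/-! ### Functional time series -/

section Series

variable {M Ω : Type*} [MeasurableSpace M] [MeasurableSpace Ω] {ν : Measure M} [SFinite ν]

/-- The kernel of `E[X_s ⊗ X_t]`. -/
def secondMoment (P : Measure Ω) (X : ℤ → Ω → Lp ℝ 2 ν) (s t : ℤ) : HS ν :=
  ∫ w, tensor (complexify (X s w)) (complexify (X t w)) ∂P

/-- `X` is a zero-mean, second-order stationary sequence in `L²(M, ν; ℝ)` whose covariance operator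
family is `R`: `R_τ = E[X_s ⊗ X_{s+τ}] = E[X_{s+τ} ⊗ X_s]`. Finiteness of `E‖X_t‖²` amounts to
nuclearity of the covariance operators. -/
structure IsStationarySeries (P : Measure Ω) (X : ℤ → Ω → Lp ℝ 2 ν) (R : ℤ → HS ν) : Prop where
  memLp : ∀ t, MemLp (X t) 2 P
  mean_zero : ∀ t, ∫ w, X t w ∂P = 0
  cov : ∀ s τ : ℤ, secondMoment P X s (s + τ) = R τ ∧ secondMoment P X (s + τ) s = R τ

/-- `F` is the (`2π`-periodically extended) spectral density operator family of the covariance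
operator family `R`: `F_θ = (2π)⁻¹ ∑_τ exp(-iθτ) R_τ` as a Fourier series, that is, `F` is
integrable over a period with `R_τ = ∫_{-π}^{π} exp(iθτ) F_θ dθ` for all `τ`. -/
structure IsSpectralDensity (R : ℤ → HS ν) (F : ℝ → HS ν) : Prop where
  periodic : Function.Periodic F (2 * π)
  integrable : IntervalIntegrable F volume (-π) (π : ℝ)
  fourier : ∀ τ : ℤ, R τ = ∫ θ in (-π)..π, Complex.exp (Complex.I * θ * τ) • F θ

/-- `L` is slowly varying at zero in Zygmund's sense: for each `δ > 0`, near `0+`, `x^δ L(x)` is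
increasing and `x^{-δ} L(x)` is decreasing. -/
def IsZygmundSlowlyVaryingAtZero (L : ℝ → ℝ) : Prop :=
  ∀ δ : ℝ, 0 < δ → ∃ ε > 0, MonotoneOn (fun x : ℝ => x ^ δ * L x) (Ioo 0 ε) ∧
    AntitoneOn (fun x : ℝ => x ^ (-δ) * L x) (Ioo 0 ε)

/-- The long-range dependence alternative: the eigenvalues of the spectral density operators `F_θ`
on the Laplace–Beltrami eigenspaces are `f_n(θ) = M_n(θ) |θ|^{-α(n)}`, where `α(n)` are the
eigenvalues of the long-range dependence operator, lying in `[l, L] ⊆ (0, 1/2)`, and `M_n(θ)` are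
those of the regular part, the operator family `Mop`. -/
structure IsLRDAlternative {Γ : ℕ → ℕ}
    (S : HilbertBasis (Σ n : ℕ, Fin (Γ n)) ℂ (Lp ℂ 2 ν))
    (F : ℝ → HS ν) (Mop : ℝ → HS ν) (m : ℕ → ℝ → ℝ) (α : ℕ → ℝ) (l L : ℝ) : Prop where
  l_mem : l ∈ Ioo (0 : ℝ) (1 / 2)
  L_mem : L ∈ Ioo (0 : ℝ) (1 / 2)
  exponent_mem : ∀ n, α n ∈ Icc l L
  regular_pos : ∀ n, ∀ θ ∈ Icc (-π) π, 0 < m n θ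
  regular_continuous : ∀ n, ContinuousOn (m n) (Icc (-π) π)
  regular_slow : ∀ n, IsZygmundSlowlyVaryingAtZero (m n)
  regular_expansion : ∀ θ ∈ Icc (-π) π, HasDiagonalExpansion S (fun n => m n θ) (Mop θ)
  regular_summable :
    ∑' τ : ℤ, nuclearNorm (∫ θ in (-π)..π, Complex.exp (Complex.I * θ * τ) • Mop θ) ≠ ⊤
  spectral_expansion : ∀ θ ∈ Icc (-π) π, θ ≠ 0 →
    HasDiagonalExpansion S (fun n => m n θ * |θ| ^ (-α n)) (F θ)

/-- The kernel `cum(X_{t₁}(x), X_{t₂}(y), X_{t₃}(z), X_{t₄}(v))` of a zero-mean sequence, at the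
point `((x, y), (z, v))`. -/
def cumulantFour (P : Measure Ω) (X : ℤ → Ω → Lp ℝ 2 ν) (t₁ t₂ t₃ t₄ : ℤ)
    (q : (M × M) × (M × M)) : ℂ :=
  (∫ w, tensor (tensor (complexify (X t₁ w)) (complexify (X t₂ w)))
      (tensor (complexify (X t₃ w)) (complexify (X t₄ w))) ∂P :
      Lp ℂ 2 ((ν.prod ν).prod (ν.prod ν))) q
    - secondMoment P X t₁ t₂ (q.1.1, q.1.2) * secondMoment P X t₃ t₄ (q.2.1, q.2.2)
    - secondMoment P X t₁ t₃ (q.1.1, q.2.1) * secondMoment P X t₂ t₄ (q.1.2, q.2.2)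
    - secondMoment P X t₁ t₄ (q.1.1, q.2.2) * secondMoment P X t₂ t₃ (q.1.2, q.2.1)

/-- The fourth-order cumulants exist, their kernels are isotropic (invariant under all isometries of
`M`), and their squared `L²(M⁴)` norms are summable. -/
structure FourthOrderAssumption {M Ω : Type*} [MetricSpace M] [MeasurableSpace M]
    [MeasurableSpace Ω] {ν : Measure M} [SFinite ν]
    (P : Measure Ω) (X : ℤ → Ω → Lp ℝ 2 ν) : Prop where
  memLp : ∀ t, MemLp (X t) 4 P
  isotropic : ∀ (t₁ t₂ t₃ : ℤ) (g : M ≃ᵢ M), ∀ᵐ q ∂((ν.prod ν).prod (ν.prod ν)),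
    cumulantFour P X t₁ t₂ t₃ 0 ((g q.1.1, g q.1.2), (g q.2.1, g q.2.2))
      = cumulantFour P X t₁ t₂ t₃ 0 q
  summable : ∑' t : ℤ × ℤ × ℤ, ∫⁻ q, ‖cumulantFour P X t.1 t.2.1 t.2.2 0 q‖ₑ ^ 2
    ∂((ν.prod ν).prod (ν.prod ν)) ≠ ⊤

/-! ### The weighted periodogram operator -/

/-- The functional discrete Fourier transform
`(2πT)^{-1/2} ∑_{t=0}^{T-1} X_t exp(-iθt)`. -/
def fDFT (X : ℤ → Ω → Lp ℝ 2 ν) (T : ℕ) (θ : ℝ) (w : Ω) : Lp ℂ 2 ν :=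
  (((Real.sqrt (2 * π * T))⁻¹ : ℝ) : ℂ) • ∑ t ∈ Finset.range T,
    Complex.exp (-Complex.I * θ * t) • complexify (X (t : ℤ) w)

/-- The periodogram operator `X̃_θ ⊗ X̃_{-θ}`. -/
def periodogram (X : ℤ → Ω → Lp ℝ 2 ν) (T : ℕ) (θ : ℝ) (w : Ω) : HS ν :=
  tensor (fDFT X T θ w) (fDFT X T (-θ) w)

/-- Conditions on the weight function: nonnegative, even, of bounded variation, vanishing off
`(-1, 1)`, square integrable, of integral one. -/
structure IsWeightFunction (W : ℝ → ℝ) : Prop where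
  nonneg : ∀ x, 0 ≤ W x
  even : ∀ x, W (-x) = W x
  boundedVariation : BoundedVariationOn W univ
  support : ∀ x, 1 ≤ |x| → W x = 0
  memLp : MemLp W 2 volume
  integral_eq_one : ∫ x, W x = 1

/-- The periodized rescaled weight `∑_{j ∈ ℤ} b⁻¹ W((x + 2πj)/b)`. -/
def periodizedWeight (W : ℝ → ℝ) (b x : ℝ) : ℝ :=
  ∑' j : ℤ, b⁻¹ * W ((x + 2 * π * j) / b)

/-- The weighted periodogram operator
`(2π/T) ∑_{s=1}^{T-1} W^{(T)}(θ - 2πs/T) P_{2πs/T}`, with bandwidth `b`. -/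
def weightedPeriodogram (X : ℤ → Ω → Lp ℝ 2 ν) (W : ℝ → ℝ) (b : ℝ) (T : ℕ) (θ : ℝ) (w : Ω) :
    HS ν :=
  (2 * π / T : ℝ) • ∑ s ∈ Finset.Icc 1 (T - 1),
    periodizedWeight W b (θ - 2 * π * s / T) • periodogram X T (2 * π * s / T) w

/-- The kernel-smoothed spectral density operator `∫_{-π}^{π} W(ξ) F_{θ - bξ} dξ`. -/
def smoothedDensity (F : ℝ → HS ν) (W : ℝ → ℝ) (b θ : ℝ) : HS ν :=
  ∫ ξ in (-π)..π, W ξ • F (θ - b * ξ)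

end Series

end

end ManifoldFTS

open ManifoldFTS

namespace ManifoldFTS

/-! ### Tensor products of square integrable functions -/

section TensorProduct

variable {X Y : Type*} [MeasurableSpace X] [MeasurableSpace Y] {μ : Measure X} {ν : Measure Y}
  [SFinite μ] [SFinite ν]

/-! Integrating over a full period removes the bandwidth from the problem. The periodized weight has
integral one over a period, so the integrated mean of the estimator is the unweighted sum `(2π/T)
∑_{s=1}^{T-1} E P_{2πs/T}`. By Fubini and periodicity of `F`, the integrated smoothed density is `∫
F = R 0`. Orthogonality of the characters of `ℤ/T` shows that the same sum over all `s = 0, …, T-1`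
equals `R 0` exactly. Hence the integrated bias is minus the single missing term `(2π/T) E P_0 = T⁻²
∑_{t,u<T} R_{u-t}` (`integral_bias`).

It remains to bound this double sum by `O(T^{3/2})`. It equals `∫ |D_T|² F` with `D_T` the Dirichlet
kernel. One factor `|D_T|` is at most `T`; the other is paired with `‖F‖` by a Cauchy–Schwarz type
estimate, using `∫ |D_T|² = 2πT` and `∫ ‖F‖² < ∞` (`norm_sum_fourierCoeff_le`). Square integrability
of `F` comes from the diagonal expansions: `‖F_θ‖ ≤ π |θ|^{-L} ‖M_θ‖₁`
(`IsLRDAlternative.enorm_le`), whose right side is square integrable by the condition on the regular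
part.

The resulting bound is `O(T^{-1/2})`, with a constant independent of the bandwidth. The claimed rate
follows since `B_T^{-1/2} ≥ 1` once `B_T < 1`. -/

theorem tensor_coeFn (f : Lp ℂ 2 μ) (g : Lp ℂ 2 ν) :
    tensor f g =ᵐ[μ.prod ν] fun p => f p.1 * g p.2 :=
  (memLp_tensor f g).coeFn_toLp

theorem tensor_add_left (f f' : Lp ℂ 2 μ) (g : Lp ℂ 2 ν) :
    tensor (f + f') g = tensor f g + tensor f' g := by
  refine Lp.ext ?_
  filter_upwards [tensor_coeFn (f + f') g, tensor_coeFn f g, tensor_coeFn f' g,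
    Lp.coeFn_add (tensor f g) (tensor f' g),
    Measure.quasiMeasurePreserving_fst.ae (Lp.coeFn_add f f')] with p h1 h2 h3 h4 h5
  rw [h1, h4, Pi.add_apply, h2, h3, h5, Pi.add_apply, add_mul]

theorem tensor_add_right (f : Lp ℂ 2 μ) (g g' : Lp ℂ 2 ν) :
    tensor f (g + g') = tensor f g + tensor f g' := by
  refine Lp.ext ?_
  filter_upwards [tensor_coeFn f (g + g'), tensor_coeFn f g, tensor_coeFn f g',
    Lp.coeFn_add (tensor f g) (tensor f g'),
    Measure.quasiMeasurePreserving_snd.ae (Lp.coeFn_add g g')] with p h1 h2 h3 h4 h5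
  rw [h1, h4, Pi.add_apply, h2, h3, h5, Pi.add_apply, mul_add]

theorem tensor_smul_left (c : ℂ) (f : Lp ℂ 2 μ) (g : Lp ℂ 2 ν) :
    tensor (c • f) g = c • tensor f g := by
  refine Lp.ext ?_
  filter_upwards [tensor_coeFn (c • f) g, tensor_coeFn f g, Lp.coeFn_smul c (tensor f g),
    Measure.quasiMeasurePreserving_fst.ae (Lp.coeFn_smul c f)] with p h1 h2 h3 h4
  rw [h1, h3, Pi.smul_apply, h2, h4, Pi.smul_apply, smul_eq_mul, smul_eq_mul, mul_assoc]

theorem tensor_smul_right (c : ℂ) (f : Lp ℂ 2 μ) (g : Lp ℂ 2 ν) :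
    tensor f (c • g) = c • tensor f g := by
  refine Lp.ext ?_
  filter_upwards [tensor_coeFn f (c • g), tensor_coeFn f g, Lp.coeFn_smul c (tensor f g),
    Measure.quasiMeasurePreserving_snd.ae (Lp.coeFn_smul c g)] with p h1 h2 h3 h4
  rw [h1, h3, Pi.smul_apply, h2, h4, Pi.smul_apply, smul_eq_mul, smul_eq_mul, mul_left_comm]

theorem inner_tensor (f f' : Lp ℂ 2 μ) (g g' : Lp ℂ 2 ν) :
    inner ℂ (tensor f g) (tensor f' g') = inner ℂ f f' * inner ℂ g g' := by
  rw [L2.inner_def, L2.inner_def, L2.inner_def, ← integral_prod_mul]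
  refine integral_congr_ae ?_
  filter_upwards [tensor_coeFn f g, tensor_coeFn f' g'] with p h1 h2
  rw [h1, h2]
  simp only [RCLike.inner_apply, map_mul]
  ring

theorem norm_tensor (f : Lp ℂ 2 μ) (g : Lp ℂ 2 ν) : ‖tensor f g‖ = ‖f‖ * ‖g‖ := by
  have h := inner_tensor f f g g
  simp only [inner_self_eq_norm_sq_to_K, ← mul_pow] at h
  norm_cast at h
  exact (sq_eq_sq₀ (norm_nonneg _) (by positivity)).1 (by exact_mod_cast h)

/-- The tensor product as a continuous bilinear map. -/
noncomputable def tensorL (μ : Measure X) (ν : Measure Y) [SFinite μ] [SFinite ν] :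
    Lp ℂ 2 μ →L[ℂ] Lp ℂ 2 ν →L[ℂ] Lp ℂ 2 (μ.prod ν) :=
  LinearMap.mkContinuous₂ (LinearMap.mk₂ ℂ tensor tensor_add_left tensor_smul_left
    tensor_add_right tensor_smul_right) 1 fun f g => by simp [norm_tensor]

@[simp] theorem tensorL_apply (f : Lp ℂ 2 μ) (g : Lp ℂ 2 ν) : tensorL μ ν f g = tensor f g := rfl

omit [SFinite μ] in
theorem inner_star_star (f g : Lp ℂ 2 μ) : inner ℂ (star f) (star g) = inner ℂ g f := by
  rw [L2.inner_def, L2.inner_def]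
  refine integral_congr_ae ?_
  filter_upwards [Lp.coeFn_star f, Lp.coeFn_star g] with p h1 h2
  rw [h1, h2]
  simp [mul_comm]

omit [SFinite μ] in
theorem norm_star_lp (f : Lp ℂ 2 μ) : ‖star f‖ = ‖f‖ := by
  have h := inner_star_star f f
  simp only [inner_self_eq_norm_sq_to_K] at h
  norm_cast at h
  exact (sq_eq_sq₀ (norm_nonneg _) (norm_nonneg _)).1 (by exact_mod_cast h)

end TensorProduct

/-! ### Diagonal kernels and the nuclear norm -/

section Diagonal

variable {X : Type*} [MeasurableSpace X] {μ : Measure X} [SFinite μ] {Γ : ℕ → ℕ}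
  {S : HilbertBasis (Σ n : ℕ, Fin (Γ n)) ℂ (Lp ℂ 2 μ)}

theorem inner_tensor_star_basis (i k : Σ n : ℕ, Fin (Γ n)) :
    inner ℂ (tensor (S i) (star (S i))) (tensor (S k) (star (S k))) = if i = k then (1 : ℂ) else 0 := by
  rw [inner_tensor, inner_star_star, orthonormal_iff_ite.1 S.orthonormal,
    orthonormal_iff_ite.1 S.orthonormal]
  by_cases h : i = k
  · simp [h]
  · simp [h, Ne.symm h]

/-- The diagonal entries of a diagonal kernel. -/
theorem HasDiagonalExpansion.inner_eq {a : ℕ → ℝ} {K : HS μ} (h : HasDiagonalExpansion S a K)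
    (i : Σ n : ℕ, Fin (Γ n)) : inner ℂ (tensor (S i) (star (S i))) K = (a i.1 : ℂ) := by
  have h1 := h.mapL (innerSL ℂ (tensor (S i) (star (S i))))
  refine h1.unique ?_
  have h2 : ∀ n, innerSL ℂ (tensor (S i) (star (S i)))
      ((a n : ℂ) • ∑ j : Fin (Γ n), tensor (S ⟨n, j⟩) (star (S ⟨n, j⟩)))
      = if n = i.1 then (a i.1 : ℂ) else 0 := by
    intro n
    rw [map_smul, map_sum]
    simp only [innerSL_apply_apply, inner_tensor_star_basis, smul_eq_mul]
    obtain ⟨k, l⟩ := i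
    by_cases hn : n = k
    · subst hn; simp
    · have : ∀ j : Fin (Γ n), ¬ ((⟨k, l⟩ : Σ n, Fin (Γ n)) = ⟨n, j⟩) := fun j hj =>
        hn (congrArg Sigma.fst hj).symm
      simp [this, hn]
  simp only [h2]
  exact hasSum_ite_eq i.1 (a i.1 : ℂ)

/-- Testing the supremum in `nuclearNorm` on one finite family of basis vectors, used as both
orthonormal systems, picks out exactly the diagonal entries, each repeated according to its
multiplicity. -/
theorem HasDiagonalExpansion.sum_le_nuclearNorm {a : ℕ → ℝ} {K : HS μ}
    (h : HasDiagonalExpansion S a K) (s : Finset (Σ n : ℕ, Fin (Γ n))) :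
    ∑ i ∈ s, ‖a i.1‖ₑ ≤ nuclearNorm K := by
  let e : Fin s.card → Lp ℂ 2 μ := fun k => S (s.equivFin.symm k)
  have he : Orthonormal ℂ e := S.orthonormal.comp _
    (Subtype.val_injective.comp s.equivFin.symm.injective)
  refine le_trans (le_of_eq ?_) (le_iSup_of_le s.card (le_iSup_of_le e (le_iSup_of_le e
    (le_iSup_of_le he (le_iSup_of_le he le_rfl)))))
  simp only [e, h.inner_eq]
  rw [Equiv.sum_comp s.equivFin.symm (fun i : s => ‖((a i.1.1 : ℝ) : ℂ)‖ₑ),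
    Finset.sum_coe_sort s (fun i => ‖((a i.1 : ℝ) : ℂ)‖ₑ)]
  refine Finset.sum_congr rfl fun i _ => ?_
  simp [enorm_eq_nnnorm]

/-- A diagonal kernel whose coefficients are dominated by those of another one is bounded by the
nuclear norm of the latter. -/
theorem HasDiagonalExpansion.enorm_le {a a' : ℕ → ℝ} {K K' : HS μ} {C : ℝ}
    (h : HasDiagonalExpansion S a K) (h' : HasDiagonalExpansion S a' K')
    (hC : ∀ n, |a' n| ≤ C * |a n|) (hC0 : 0 ≤ C) :
    ‖K'‖ₑ ≤ ENNReal.ofReal C * nuclearNorm K := by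
  refine le_of_tendsto (continuous_enorm.continuousAt.tendsto.comp h') (Eventually.of_forall ?_)
  intro s
  have h0 : ∀ n, ‖a' n‖ₑ ≤ ENNReal.ofReal C * ‖a n‖ₑ := by
    intro n
    rw [← ofReal_norm, ← ofReal_norm, ← ENNReal.ofReal_mul hC0]
    exact ENNReal.ofReal_le_ofReal (hC n)
  have h1 : ∀ i, ‖tensor (S i) (star (S i))‖ₑ = 1 := by
    intro i
    rw [← ofReal_norm, norm_tensor, norm_star_lp, S.orthonormal.1]; simp
  -- The crude triangle inequality suffices: each rank-one kernel has norm one, so block `n` costs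
  -- `Γ n` copies of its coefficient, which is how the nuclear norm counts it.
  calc ‖∑ n ∈ s, (a' n : ℂ) • ∑ j : Fin (Γ n), tensor (S ⟨n, j⟩) (star (S ⟨n, j⟩))‖ₑ
      ≤ ∑ n ∈ s, ∑ j : Fin (Γ n), ENNReal.ofReal C * ‖a n‖ₑ := by
        refine (enorm_sum_le _ _).trans (Finset.sum_le_sum fun n _ => ?_)
        rw [enorm_smul]
        refine (mul_le_mul_right (enorm_sum_le _ _) _).trans ?_
        simp only [h1, Finset.mul_sum, mul_one]
        refine Finset.sum_le_sum fun j _ => le_trans (le_of_eq ?_) (h0 n)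
        simp [enorm_eq_nnnorm]
    _ = ENNReal.ofReal C * ∑ i ∈ s.sigma (fun n => (Finset.univ : Finset (Fin (Γ n)))), ‖a i.1‖ₑ := by
        rw [Finset.sum_sigma, Finset.mul_sum]
        simp only [Finset.mul_sum]
    _ ≤ _ := mul_le_mul_right (h.sum_le_nuclearNorm _) _

end Diagonal

/-! ### Mean of the periodogram and summation over Fourier frequencies -/

section Expectation

variable {M Ω : Type*} [MeasurableSpace M] [MeasurableSpace Ω] {ν : Measure M} [SFinite ν]
  {P : Measure Ω} {X : ℤ → Ω → Lp ℝ 2 ν} {R : ℤ → HS ν}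

theorem integrable_tensor_complexify (hX : ∀ t, MemLp (X t) 2 P) (s t : ℤ) :
    Integrable (fun w => tensor (complexify (X s w)) (complexify (X t w))) P := by
  have hc : ∀ t, MemLp (fun w => complexify (X t w)) 2 P := fun t =>
    ((Complex.ofRealCLM.compLpL 2 ν).comp_memLp' (hX t))
  have h1 : AEStronglyMeasurable
      (fun w => tensorL ν ν (complexify (X s w)) (complexify (X t w))) P :=
    (tensorL ν ν).aestronglyMeasurable_comp₂ (hc s).1 (hc t).1
  refine Integrable.mono' ((hc s).norm.integrable_mul (hc t).norm) h1
    (Eventually.of_forall fun w => ?_)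
  simp [norm_tensor]

omit [MeasurableSpace Ω] in
-- The second factor is the transform at `-θ`, without conjugation, so the phases combine to depend
-- on `u - t` only; stationarity then turns the expectation into a sum of `R_{u-t}`.
theorem periodogram_eq (T : ℕ) (θ : ℝ) (w : Ω) :
    periodogram X T θ w = (((2 * π * T)⁻¹ : ℝ) : ℂ) • ∑ t ∈ Finset.range T, ∑ u ∈ Finset.range T,
      Complex.exp (Complex.I * θ * ((u : ℂ) - t)) •
        tensor (complexify (X (t : ℤ) w)) (complexify (X (u : ℤ) w)) := by
  have hs : (0 : ℝ) ≤ 2 * π * T := by positivity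
  simp only [periodogram, fDFT, ← tensorL_apply]
  simp only [map_smul, map_sum, _root_.sum_apply, _root_.smul_apply,
    smul_smul, Finset.smul_sum]
  rw [Finset.sum_comm]
  refine Finset.sum_congr rfl fun t _ => Finset.sum_congr rfl fun u _ => ?_
  congr 1
  rw [← Real.mul_self_sqrt hs, Real.sqrt_mul_self (Real.sqrt_nonneg _), mul_inv,
    show Complex.I * θ * ((u : ℂ) - t) = -Complex.I * θ * t + -Complex.I * ((-θ : ℝ) : ℂ) * u by
      push_cast; ring, Complex.exp_add]
  push_cast
  ring

theorem integrable_smul_tensor_complexify (hX : ∀ t, MemLp (X t) 2 P) (c : ℂ) (s t : ℤ) :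
    Integrable (fun w => c • tensor (complexify (X s w)) (complexify (X t w))) P :=
  (integrable_tensor_complexify hX s t).smul c

theorem integrable_periodogram (hX : ∀ t, MemLp (X t) 2 P) (T : ℕ) (θ : ℝ) :
    Integrable (fun w => periodogram X T θ w) P := by
  simp only [periodogram_eq]
  exact (integrable_finsetSum _ fun t _ => integrable_finsetSum _ fun u _ =>
    integrable_smul_tensor_complexify hX _ _ _).smul (((2 * π * T)⁻¹ : ℝ) : ℂ)

theorem integrable_smul_periodogram (hX : ∀ t, MemLp (X t) 2 P) (c : ℝ) (T : ℕ) (θ : ℝ) :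
    Integrable (fun w => c • periodogram X T θ w) P :=
  (integrable_periodogram hX T θ).smul c

theorem integrable_weightedPeriodogram (hX : ∀ t, MemLp (X t) 2 P) (W : ℝ → ℝ) (b : ℝ) (T : ℕ)
    (θ : ℝ) : Integrable (fun w => weightedPeriodogram X W b T θ w) P :=
  (integrable_finsetSum _ fun _ _ => integrable_smul_periodogram hX _ T _).smul (2 * π / T : ℝ)

theorem integral_weightedPeriodogram (hX : ∀ t, MemLp (X t) 2 P) (W : ℝ → ℝ) (b : ℝ) (T : ℕ)
    (θ : ℝ) : ∫ w, weightedPeriodogram X W b T θ w ∂P =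
      (2 * π / T : ℝ) • ∑ s ∈ Finset.Icc 1 (T - 1),
        periodizedWeight W b (θ - 2 * π * s / T) • ∫ w, periodogram X T (2 * π * s / T) w ∂P := by
  simp only [weightedPeriodogram]
  rw [integral_smul, integral_finsetSum _ fun _ _ => integrable_smul_periodogram hX _ T _]
  simp only [integral_smul]

theorem integral_periodogram (hX : IsStationarySeries P X R) (T : ℕ) (θ : ℝ) :
    ∫ w, periodogram X T θ w ∂P =
      (((2 * π * T)⁻¹ : ℝ) : ℂ) • ∑ t ∈ Finset.range T, ∑ u ∈ Finset.range T,
        Complex.exp (Complex.I * θ * ((u : ℂ) - t)) • R ((u : ℤ) - t) := by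
  simp only [periodogram_eq]
  have hi := fun (t u : ℕ) => integrable_smul_tensor_complexify hX.memLp
    (Complex.exp (Complex.I * θ * ((u : ℂ) - t))) t u
  rw [integral_smul, integral_finsetSum _ fun t _ => integrable_finsetSum _ fun u _ => hi t u]
  congr 1
  refine Finset.sum_congr rfl fun t _ => ?_
  rw [integral_finsetSum _ fun u _ => hi t u]
  refine Finset.sum_congr rfl fun u _ => ?_
  rw [integral_smul, ← (hX.cov t (u - t)).1, add_sub_cancel]
  rfl

/-- Orthogonality of the characters of `ℤ/T`. -/
theorem sum_exp_fourierFrequency {T t u : ℕ} (ht : t < T) (hu : u < T) :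
    ∑ s ∈ Finset.range T, Complex.exp (Complex.I * ((2 * π * s / T : ℝ) : ℂ) * ((u : ℂ) - t)) =
      if t = u then (T : ℂ) else 0 := by
  have hT : (T : ℂ) ≠ 0 := by exact_mod_cast (show T ≠ 0 by omega)
  set z : ℂ := Complex.exp (2 * π * Complex.I * (((u : ℤ) - t : ℤ) / T : ℂ)) with hz
  have h1 : ∀ s : ℕ, Complex.exp (Complex.I * ((2 * π * s / T : ℝ) : ℂ) * ((u : ℂ) - t)) = z ^ s := by
    intro s
    rw [hz, ← Complex.exp_nat_mul]
    congr 1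
    push_cast
    field_simp
  simp only [h1]
  split_ifs with h
  · subst h; simp [hz]
  · have hz1 : z ≠ 1 := by
      intro h2
      rw [hz, Complex.exp_eq_one_iff] at h2
      obtain ⟨n, hn⟩ := h2
      have h3 : (((u : ℤ) - t : ℤ) : ℂ) = ((n * T : ℤ) : ℂ) := by
        have h4 : (2 * π * Complex.I : ℂ) ≠ 0 := Complex.two_pi_I_ne_zero
        have h5 : (2 * π * Complex.I : ℂ) * (((u : ℤ) - t : ℤ) / T : ℂ) = 2 * π * Complex.I * n := by
          rw [hn]; ring
        have h6 := mul_left_cancel₀ h4 h5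
        rw [div_eq_iff hT] at h6
        rw [h6]; push_cast; ring
      have h4 : (u : ℤ) - t = n * T := by exact_mod_cast h3
      have h5 : (T : ℤ) ∣ (u : ℤ) - t := ⟨n, by rw [h4]; ring⟩
      -- Both indices lie in `[0, T)`, so their difference is a multiple of `T` only if it vanishes.
      have h6 := Int.eq_zero_of_abs_lt_dvd h5 (by rw [abs_lt]; omega)
      omega
    have hzT : z ^ T = 1 := by
      rw [hz, ← Complex.exp_nat_mul, Complex.exp_eq_one_iff]
      exact ⟨(u : ℤ) - t, by field_simp⟩
    rw [geom_sum_eq hz1, hzT]; simp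

/-- Summing over all `T` Fourier frequencies kills every off-diagonal pair `t ≠ u`. The `T` diagonal
pairs contribute `T • R 0` each, and the factor `T²` cancels the normalizations `2π/T` and
`1/(2πT)`. The identity is exact, with no discretization error. -/
theorem sum_integral_periodogram (hX : IsStationarySeries P X R) {T : ℕ} (hT : 0 < T) :
    (2 * π / T : ℝ) • ∑ s ∈ Finset.range T, ∫ w, periodogram X T (2 * π * s / T) w ∂P = R 0 := by
  have hT0 : (T : ℂ) ≠ 0 := by exact_mod_cast hT.ne'
  simp only [integral_periodogram hX]
  rw [← Finset.smul_sum, Finset.sum_comm]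
  have h1 : ∀ t ∈ Finset.range T, ∑ s ∈ Finset.range T, ∑ u ∈ Finset.range T,
      Complex.exp (Complex.I * ((2 * π * s / T : ℝ) : ℂ) * ((u : ℂ) - t)) • R ((u : ℤ) - t)
      = (T : ℂ) • R 0 := by
    intro t ht
    rw [Finset.sum_comm]
    simp only [← Finset.sum_smul]
    rw [Finset.sum_eq_single_of_mem t ht]
    · rw [sum_exp_fourierFrequency (Finset.mem_range.1 ht) (Finset.mem_range.1 ht)]; simp
    · intro u hu hut
      rw [sum_exp_fourierFrequency (Finset.mem_range.1 ht) (Finset.mem_range.1 hu),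
        if_neg (Ne.symm hut), zero_smul]
  rw [Finset.sum_congr rfl h1, Finset.sum_const, Finset.card_range, ← Nat.cast_smul_eq_nsmul ℂ,
    ← algebraMap_smul ℂ (2 * π / T : ℝ), smul_smul, smul_smul, smul_smul]
  have hpi : (π : ℂ) ≠ 0 := by exact_mod_cast Real.pi_ne_zero
  convert one_smul ℂ (R 0) using 2
  rw [Complex.coe_algebraMap]
  push_cast
  field_simp

end Expectation

/-! ### Dirichlet kernel and growth of double sums of Fourier coefficients -/

section Dirichlet

theorem integral_exp_int (n : ℤ) :
    ∫ θ in (-π)..π, Complex.exp (Complex.I * (θ : ℂ) * n) = if n = 0 then (2 * π : ℂ) else 0 := by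
  split_ifs with h
  · subst h; simp; ring
  · have hc : Complex.I * (n : ℂ) ≠ 0 := mul_ne_zero Complex.I_ne_zero (by exact_mod_cast h)
    have h1 : ∀ θ : ℝ, Complex.I * (θ : ℂ) * n = Complex.I * n * θ := fun θ => by ring
    simp only [h1]
    rw [integral_exp_mul_complex hc]
    have h2 : Complex.exp (Complex.I * n * (π : ℝ)) = Complex.exp (Complex.I * n * ((-π : ℝ) : ℂ)) := by
      rw [Complex.exp_eq_exp_iff_exists_int]
      exact ⟨n, by push_cast; ring⟩
    rw [h2, sub_self, zero_div]

/-- The Dirichlet kernel `∑_{t < T} exp(iθt)`. -/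
noncomputable def dirichletSum (T : ℕ) (θ : ℝ) : ℂ :=
  ∑ u ∈ Finset.range T, Complex.exp (Complex.I * θ * u)

theorem continuous_dirichletSum (T : ℕ) : Continuous (dirichletSum T) := by
  unfold dirichletSum; fun_prop

theorem norm_dirichletSum_le (T : ℕ) (θ : ℝ) : ‖dirichletSum T θ‖ ≤ T := by
  refine (norm_sum_le _ _).trans (le_of_eq ?_)
  have h : ∀ u : ℕ, ‖Complex.exp (Complex.I * θ * u)‖ = 1 := fun u => by
    rw [show Complex.I * θ * u = ((θ * u : ℝ) : ℂ) * Complex.I by push_cast; ring,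
      Complex.norm_exp_ofReal_mul_I]
  simp [h]

theorem sq_norm_dirichletSum (T : ℕ) (θ : ℝ) : ((‖dirichletSum T θ‖ ^ 2 : ℝ) : ℂ) =
    ∑ t ∈ Finset.range T, ∑ u ∈ Finset.range T,
      Complex.exp (Complex.I * θ * ((u : ℤ) - t : ℤ)) := by
  rw [← Complex.normSq_eq_norm_sq, Complex.normSq_eq_conj_mul_self]
  simp only [dirichletSum, map_sum, Finset.sum_mul_sum, ← Complex.exp_conj, ← Complex.exp_add]
  refine Finset.sum_congr rfl fun t _ => Finset.sum_congr rfl fun u _ => ?_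
  congr 1
  simp
  ring

/-- Parseval: after expanding the square, only the `T` diagonal terms have nonzero integral, each
equal to `2π`. -/
theorem integral_sq_norm_dirichletSum (T : ℕ) :
    ∫ θ in (-π)..π, ‖dirichletSum T θ‖ ^ 2 = 2 * π * T := by
  have h : ((∫ θ in (-π)..π, ‖dirichletSum T θ‖ ^ 2 : ℝ) : ℂ) = ((2 * π * T : ℝ) : ℂ) := by
    rw [← intervalIntegral.integral_ofReal]
    simp only [sq_norm_dirichletSum]
    have hc : ∀ n : ℤ, IntervalIntegrable
        (fun θ : ℝ => Complex.exp (Complex.I * (θ : ℂ) * n)) volume (-π) π := fun n =>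
      Continuous.intervalIntegrable (by fun_prop) _ _
    rw [intervalIntegral.integral_finsetSum fun t _ =>
      Continuous.intervalIntegrable (by fun_prop) _ _]
    have h1 : ∀ t ∈ Finset.range T, ∫ θ in (-π)..π, ∑ u ∈ Finset.range T,
        Complex.exp (Complex.I * (θ : ℂ) * ((u : ℤ) - t : ℤ)) = 2 * π := by
      intro t ht
      rw [intervalIntegral.integral_finsetSum fun u _ => hc _]
      simp only [integral_exp_int]
      rw [Finset.sum_eq_single_of_mem t ht]
      · simp
      · intro u _ hut
        rw [if_neg]; omega
    rw [Finset.sum_congr rfl h1]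
    simp; ring
  exact_mod_cast h

/-- If `F` is square integrable over a period with Fourier coefficients `R_τ`, then the
double sum of `R_{u-t}` over `t, u < T` is `O(T^{3/2})`. -/
theorem norm_sum_fourierCoeff_le {E : Type*} [NormedAddCommGroup E] [NormedSpace ℂ E]
    {F : ℝ → E} {R : ℤ → E} (hF : IntervalIntegrable F volume (-π) π)
    (hR : ∀ τ : ℤ, R τ = ∫ θ in (-π)..π, Complex.exp (Complex.I * θ * τ) • F θ)
    (hF2 : IntervalIntegrable (fun θ => ‖F θ‖ ^ 2) volume (-π) π) (T : ℕ) :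
    ‖∑ t ∈ Finset.range T, ∑ u ∈ Finset.range T, R ((u : ℤ) - t)‖ ≤
      T * (√T * ((2 * π + ∫ θ in (-π)..π, ‖F θ‖ ^ 2) / 2)) := by
  have hpi : -π ≤ π := by linarith [Real.pi_pos]
  rcases Nat.eq_zero_or_pos T with rfl | hT
  · simp
  have hi : ∀ n : ℤ, IntervalIntegrable
      (fun θ : ℝ => Complex.exp (Complex.I * (θ : ℂ) * n) • F θ) volume (-π) π := fun n =>
    hF.continuousOn_smul (Continuous.continuousOn (by fun_prop))
  have h1 : ∑ t ∈ Finset.range T, ∑ u ∈ Finset.range T, R ((u : ℤ) - t)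
      = ∫ θ in (-π)..π, ((‖dirichletSum T θ‖ ^ 2 : ℝ) : ℂ) • F θ := by
    simp only [sq_norm_dirichletSum, Finset.sum_smul]
    have hi' : ∀ t : ℕ, IntervalIntegrable (fun θ : ℝ => ∑ u ∈ Finset.range T,
        Complex.exp (Complex.I * (θ : ℂ) * ((u : ℤ) - t : ℤ)) • F θ) volume (-π) π := fun t => by
      simpa only [Finset.sum_fn] using
        IntervalIntegrable.sum (Finset.range T) fun u _ => hi ((u : ℤ) - t)
    rw [intervalIntegral.integral_finsetSum fun t _ => hi' t]
    refine Finset.sum_congr rfl fun t _ => ?_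
    rw [intervalIntegral.integral_finsetSum fun u _ => hi _]
    exact Finset.sum_congr rfl fun u _ => hR _
  have hT' : (0 : ℝ) < √T := Real.sqrt_pos.2 (by exact_mod_cast hT)
  have hD : IntervalIntegrable (fun θ => ‖dirichletSum T θ‖ ^ 2) volume (-π) π :=
    ((continuous_dirichletSum T).norm.pow 2).intervalIntegrable _ _
  -- The majorant comes from `|D| ≤ T` for one factor and weighted AM–GM for `|D| ‖F‖`. The weight
  -- `√T` balances the two halves: as `∫ |D|² = 2πT`, both integrate to order `√T`.
  have hb : IntervalIntegrable (fun θ => (T : ℝ) * (((√T)⁻¹ * ‖dirichletSum T θ‖ ^ 2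
      + √T * ‖F θ‖ ^ 2) / 2)) volume (-π) π :=
    (((hD.const_mul _).add (hF2.const_mul _)).div_const 2).const_mul _
  rw [h1]
  refine (intervalIntegral.norm_integral_le_of_norm_le hpi (Eventually.of_forall fun θ _ => ?_)
    hb).trans (le_of_eq ?_)
  · rw [norm_smul, Complex.norm_real, Real.norm_eq_abs, abs_of_nonneg (by positivity), sq,
      mul_assoc]
    refine mul_le_mul (norm_dirichletSum_le T θ) ?_ (by positivity) (by positivity)
    have h2 : 0 ≤ (√T)⁻¹ * (‖dirichletSum T θ‖ - √T * ‖F θ‖) ^ 2 := by positivity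
    have h3 : (√T)⁻¹ * (‖dirichletSum T θ‖ - √T * ‖F θ‖) ^ 2 = (√T)⁻¹ * ‖dirichletSum T θ‖ ^ 2
        + √T * ‖F θ‖ ^ 2 - 2 * (‖dirichletSum T θ‖ * ‖F θ‖) := by
      field_simp; ring
    linarith
  · rw [intervalIntegral.integral_const_mul, intervalIntegral.integral_div,
      intervalIntegral.integral_add (hD.const_mul _) (hF2.const_mul _),
      intervalIntegral.integral_const_mul, intervalIntegral.integral_const_mul,
      integral_sq_norm_dirichletSum]
    have h4 : (√T)⁻¹ * (2 * π * T) = √T * (2 * π) := by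
      rw [inv_mul_eq_div, div_eq_iff hT'.ne']
      linear_combination (-2 * π) * Real.mul_self_sqrt (Nat.cast_nonneg (α := ℝ) T)
    rw [h4]; ring

end Dirichlet

/-! ### Square integrability of the spectral density -/

section Spectral

variable {M : Type*} [MeasurableSpace M] {ν : Measure M} [SFinite ν] {Γ : ℕ → ℕ}
  {S : HilbertBasis (Σ n : ℕ, Fin (Γ n)) ℂ (Lp ℂ 2 ν)} {F Mop : ℝ → HS ν} {m : ℕ → ℝ → ℝ}
  {α : ℕ → ℝ} {l L : ℝ} {R : ℤ → HS ν}

/-- The eigenvalues of `F θ` are those of `Mop θ` times `|θ|^{-α(n)} = |θ|^{L-α(n)} |θ|^{-L}`. Since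
`0 ≤ L - α(n) ≤ 1` and `|θ| ≤ π`, the first factor is at most `π`, uniformly in `n`. -/
theorem IsLRDAlternative.enorm_le (h : IsLRDAlternative S F Mop m α l L) {θ : ℝ}
    (hθ : θ ∈ Icc (-π) π) (h0 : θ ≠ 0) :
    ‖F θ‖ₑ ≤ ENNReal.ofReal (π * |θ| ^ (-L)) * nuclearNorm (Mop θ) := by
  have hpos : 0 < |θ| := abs_pos.2 h0
  refine (h.regular_expansion θ hθ).enorm_le (h.spectral_expansion θ hθ h0) (fun n => ?_)
    (by positivity)
  have hl := h.l_mem.1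
  have hL := h.L_mem.2
  obtain ⟨h1, h2⟩ := h.exponent_mem n
  rw [abs_mul, abs_of_pos (Real.rpow_pos_of_pos hpos _), mul_comm]
  refine mul_le_mul_of_nonneg_right ?_ (abs_nonneg _)
  have h3 : |θ| ^ (-α n) = |θ| ^ (L - α n) * |θ| ^ (-L) := by
    rw [← Real.rpow_add hpos]; ring_nf
  rw [h3]
  refine mul_le_mul_of_nonneg_right ?_ (by positivity)
  calc |θ| ^ (L - α n) ≤ π ^ (L - α n) :=
        Real.rpow_le_rpow hpos.le (abs_le.2 hθ) (by linarith)
    _ ≤ π ^ (1 : ℝ) := Real.rpow_le_rpow_of_exponent_le (by linarith [Real.pi_gt_three])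
        (by linarith)
    _ = π := Real.rpow_one _

theorem IsLRDAlternative.intervalIntegrable_sq_norm (h : IsLRDAlternative S F Mop m α l L)
    (hF : IsSpectralDensity R F)
    (hreg : ∫⁻ θ in Icc (-π) π,
      nuclearNorm (Mop θ) ^ 2 * ENNReal.ofReal (|θ| ^ (-2 * L)) ≠ ⊤) :
    IntervalIntegrable (fun θ => ‖F θ‖ ^ 2) volume (-π) π := by
  have hpi : -π ≤ π := by linarith [Real.pi_pos]
  rw [intervalIntegrable_iff_integrableOn_Icc_of_le hpi]
  have hm : AEStronglyMeasurable F (volume.restrict (Icc (-π) π)) :=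
    ((intervalIntegrable_iff_integrableOn_Icc_of_le hpi).1 hF.integrable).1
  refine ⟨hm.norm.pow 2, ?_⟩
  refine lt_of_le_of_lt ?_ (ENNReal.mul_lt_top (ENNReal.ofReal_lt_top (r := π ^ 2))
    (lt_top_iff_ne_top.2 hreg))
  rw [← lintegral_const_mul' _ _ ENNReal.ofReal_ne_top]
  refine lintegral_mono_ae ?_
  -- The expansion of `F` is available only away from the singular frequency, which is a null set.
  have h0 : ∀ᵐ θ ∂(volume.restrict (Icc (-π) π)), θ ≠ (0 : ℝ) :=
    ae_restrict_of_ae (Measure.ae_ne volume 0)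
  filter_upwards [h0, ae_restrict_mem measurableSet_Icc] with θ hθ hmem
  have hpos : 0 < |θ| := abs_pos.2 hθ
  rw [enorm_pow, enorm_norm]
  refine (pow_le_pow_left' (h.enorm_le hmem hθ) 2).trans (le_of_eq ?_)
  rw [mul_pow, ← ENNReal.ofReal_pow (by positivity), mul_pow, ← Real.rpow_natCast (|θ| ^ (-L)),
    ← Real.rpow_mul hpos.le, ENNReal.ofReal_mul (by positivity)]
  rw [show -L * ((2 : ℕ) : ℝ) = -2 * L by push_cast; ring]
  ring

end Spectral

/-! ### The weight function and its periodization -/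

section Weight

variable {W : ℝ → ℝ}

theorem IsWeightFunction.integrable (hW : IsWeightFunction W) : Integrable W := by
  rw [← integrableOn_iff_integrable_of_support_subset (s := Icc (-1) 1)]
  · exact (hW.memLp.restrict _).integrable one_le_two
  · intro x hx
    by_contra h
    refine hx (hW.support x ?_)
    by_contra h1
    exact h (abs_le.1 (not_le.1 h1).le)

/-- The total variation controls the distance to the value at `1`, which is zero. -/
theorem IsWeightFunction.norm_le (hW : IsWeightFunction W) (x : ℝ) :
    ‖W x‖ ≤ (eVariationOn W univ).toReal := by
  have h := hW.boundedVariation.dist_le (mem_univ x) (mem_univ (1 : ℝ))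
  rwa [hW.support 1 (by simp), dist_zero_right] at h

theorem IsWeightFunction.intervalIntegral_eq_one (hW : IsWeightFunction W) :
    ∫ ξ in (-π)..π, W ξ = 1 := by
  rw [intervalIntegral.integral_eq_integral_of_support_subset, hW.integral_eq_one]
  intro x hx
  have h1 : |x| < 1 := by
    by_contra h1
    exact hx (hW.support x (not_lt.1 h1))
  rw [abs_lt] at h1
  have := Real.pi_gt_three
  constructor <;> linarith

/-- Only boundedly many translates contribute to the periodized weight over a period. -/
theorem IsWeightFunction.exists_translate_eq_zero (hW : IsWeightFunction W) {b : ℝ} (hb : 0 < b)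
    (c : ℝ) : ∃ s : Finset ℤ, ∀ j ∉ s, ∀ θ ∈ Icc (-π) π,
      b⁻¹ * W ((θ - c + 2 * π * j) / b) = 0 := by
  have hpi := Real.pi_pos
  -- For `|j| ≥ N` the argument has modulus at least `2πN - π - |c| ≥ b`, outside the support after
  -- division by `b`.
  obtain ⟨N, hN⟩ := exists_nat_ge ((b + π + |c|) / (2 * π))
  rw [div_le_iff₀ (by positivity)] at hN
  refine ⟨Finset.Icc (-N : ℤ) N, fun j hj θ hθ => ?_⟩
  rw [hW.support, mul_zero]
  rw [abs_div, abs_of_pos hb, le_div_iff₀ hb, one_mul]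
  have hj' : (N : ℝ) ≤ |(j : ℝ)| := by
    have : (N : ℤ) ≤ |j| := by
      by_contra h
      rw [not_le, abs_lt] at h
      exact hj (Finset.mem_Icc.2 ⟨h.1.le, h.2.le⟩)
    exact_mod_cast this
  have h1 : |2 * π * (j : ℝ)| = 2 * π * |(j : ℝ)| := by
    rw [abs_mul, abs_of_pos (by positivity)]
  have h2 : |2 * π * (j : ℝ)| - |c - θ| ≤ |θ - c + 2 * π * j| := by
    have := abs_sub_abs_le_abs_sub (2 * π * (j : ℝ)) (c - θ)
    rwa [show 2 * π * (j : ℝ) - (c - θ) = θ - c + 2 * π * j by ring] at this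
  have h3 : |c - θ| ≤ |c| + π := (abs_sub c θ).trans (by gcongr; exact abs_le.2 hθ)
  have h4 : 2 * π * (N : ℝ) ≤ 2 * π * |(j : ℝ)| := by gcongr
  linarith

theorem IsWeightFunction.integrable_translate (hW : IsWeightFunction W) {b : ℝ} (hb : 0 < b)
    (c : ℝ) : Integrable (fun θ => b⁻¹ * W ((θ + c) / b)) :=
  ((hW.integrable.comp_div hb.ne').comp_add_right c).const_mul _

/-- Unfolding: the integrals of the translates over one period are the integrals of `b⁻¹ W(·/b)`
over consecutive periods, which tile the line and add up to `∫ W = 1`. -/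
theorem IsWeightFunction.intervalIntegrable_periodizedWeight (hW : IsWeightFunction W) {b : ℝ}
    (hb : 0 < b) (c : ℝ) :
    IntervalIntegrable (fun θ => periodizedWeight W b (θ - c)) volume (-π) π ∧
      ∫ θ in (-π)..π, periodizedWeight W b (θ - c) = 1 := by
  have hpi := Real.pi_pos
  obtain ⟨s, hs⟩ := hW.exists_translate_eq_zero hb c
  have hIcc : uIcc (-π) π = Icc (-π) π := uIcc_of_le (by linarith)
  have heq : EqOn (fun θ => periodizedWeight W b (θ - c))
      (fun θ => ∑ j ∈ s, b⁻¹ * W ((θ - c + 2 * π * j) / b)) (uIcc (-π) π) := by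
    intro θ hθ
    rw [hIcc] at hθ
    exact tsum_eq_sum fun j hj => hs j hj θ hθ
  have hi : ∀ j : ℤ, Integrable (fun θ => b⁻¹ * W ((θ - c + 2 * π * j) / b)) := by
    intro j
    have h := hW.integrable_translate hb (-c + 2 * π * j)
    refine h.congr (Eventually.of_forall fun θ => ?_)
    simp only
    rw [show θ + (-c + 2 * π * j) = θ - c + 2 * π * j by ring]
  have hsum : IntervalIntegrable (fun θ => ∑ j ∈ s, b⁻¹ * W ((θ - c + 2 * π * j) / b))
      volume (-π) π := (integrable_finsetSum _ fun j _ => hi j).intervalIntegrable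
  refine ⟨hsum.congr (fun θ hθ => (heq (uIoc_subset_uIcc hθ)).symm), ?_⟩
  rw [intervalIntegral.integral_congr heq,
    intervalIntegral.integral_finsetSum fun j _ => (hi j).intervalIntegrable]
  -- The tiling is by unit intervals, hence the rescaling by `2π`. The base point `(-π - c)/(2π)`
  -- makes the `j`-th tile correspond to `θ ∈ [-π, π]` under `2πx = θ - c + 2πj`.
  have h0 : Integrable (fun x => b⁻¹ * W (2 * π * x / b)) :=
    ((hW.integrable.comp_div hb.ne').comp_mul_left' (by positivity : (2 * π) ≠ 0)).const_mul _
  have h1 := h0.hasSum_intervalIntegral ((-π - c) / (2 * π))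
  have h2 : ∫ x, b⁻¹ * W (2 * π * x / b) = (2 * π)⁻¹ := by
    rw [integral_const_mul, Measure.integral_comp_mul_left (fun x => W (x / b)),
      Measure.integral_comp_div, hW.integral_eq_one, abs_of_pos hb,
      abs_of_pos (by positivity)]
    simp only [smul_eq_mul]
    field_simp
  have h3 : ∀ j : ℤ, ∫ x in ((-π - c) / (2 * π) + j)..((-π - c) / (2 * π) + j + 1),
      b⁻¹ * W (2 * π * x / b) =
      (2 * π)⁻¹ * ∫ θ in (-π)..π, b⁻¹ * W ((θ - c + 2 * π * j) / b) := by
    intro j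
    rw [intervalIntegral.integral_comp_mul_left (fun x => b⁻¹ * W (x / b)) (by positivity),
      smul_eq_mul]
    congr 1
    have h4 : ∀ θ, b⁻¹ * W ((θ - c + 2 * π * j) / b) = b⁻¹ * W ((θ + (-c + 2 * π * j)) / b) :=
      fun θ => by rw [show θ + (-c + 2 * π * j) = θ - c + 2 * π * j by ring]
    simp only [h4]
    rw [intervalIntegral.integral_comp_add_right (fun x => b⁻¹ * W (x / b))]
    congr 1 <;> field_simp <;> ring
  simp only [h2, h3] at h1
  have h5 := h1.mul_left (2 * π)
  have hne : 2 * π ≠ 0 := by positivity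
  simp only [mul_inv_cancel_left₀ hne, mul_inv_cancel₀ hne] at h5
  refine (hasSum_sum_of_ne_finset_zero fun j hj => ?_).unique h5
  rw [intervalIntegral.integral_congr (g := fun _ => 0) fun θ hθ => hs j hj θ (hIcc ▸ hθ)]
  simp

end Weight

/-! ### Integrating the smoothed density over a period -/

section Smoothing

variable {E : Type*} [NormedAddCommGroup E] [NormedSpace ℝ E] {W : ℝ → ℝ} {F : ℝ → E}

omit [NormedSpace ℝ E] in
theorem intervalIntegrable_of_periodic (hF : Function.Periodic F (2 * π))
    (hi : IntervalIntegrable F volume (-π) π) (a b : ℝ) : IntervalIntegrable F volume a b :=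
  hF.intervalIntegrable (t := -π) (by positivity) (by convert hi using 1; ring) a b

theorem IsWeightFunction.intervalIntegrable_smul (hW : IsWeightFunction W)
    (hF : Function.Periodic F (2 * π)) (hi : IntervalIntegrable F volume (-π) π) {b : ℝ}
    (hb : 0 < b) (θ : ℝ) :
    IntervalIntegrable (fun ξ => W ξ • F (θ - b * ξ)) volume (-π) π := by
  have h1 : IntervalIntegrable (fun x => F (θ - x)) volume (b * (-π)) (b * π) := by
    have := (intervalIntegrable_of_periodic hF hi (θ - b * (-π)) (θ - b * π)).comp_sub_left θ
    simpa using this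
  have h2 : IntervalIntegrable (fun ξ => F (θ - b * ξ)) volume (-π) π := by
    have := h1.comp_mul_left (c := b)
    rwa [mul_div_cancel_left₀ _ hb.ne', mul_div_cancel_left₀ _ hb.ne'] at this
  rw [intervalIntegrable_iff] at h2 ⊢
  exact h2.bdd_smul _ hW.integrable.1.restrict (Eventually.of_forall hW.norm_le)

/-- The shear `(ξ, θ) ↦ (ξ, θ - bξ)` preserves Lebesgue measure, so integrability of a tensor
product `W(ξ) G(x)` pulls back along it. -/
theorem IsWeightFunction.integrable_uncurry_smul (hW : IsWeightFunction W)
    (hF : Function.Periodic F (2 * π)) (hi : IntervalIntegrable F volume (-π) π) {b : ℝ}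
    (hb : 0 < b) :
    Integrable (fun p : ℝ × ℝ => W p.1 • F (p.2 - b * p.1))
      ((volume.restrict (Ioc (-π) π)).prod (volume.restrict (Ioc (-π) π))) := by
  have hpi := Real.pi_pos
  -- A periodic `F` need not be integrable on the line, so it is truncated to `[-c, c]`, which
  -- contains `θ - bξ` for all `ξ, θ ∈ (-π, π]`.
  set c := π + b * π with hc
  have hc0 : 0 < c := by positivity
  set G := (Icc (-c) c).indicator F with hG
  have hGi : Integrable G := by
    rw [hG, integrable_indicator_iff measurableSet_Icc]
    exact (intervalIntegrable_iff_integrableOn_Icc_of_le (by linarith)).1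
      (intervalIntegrable_of_periodic hF hi _ _)
  have hmp : MeasurePreserving (fun p : ℝ × ℝ => (p.1, p.2 - b * p.1))
      (volume.prod volume) (volume.prod volume) :=
    (MeasurePreserving.id volume).skew_product (g := fun ξ θ => θ - b * ξ) (by fun_prop)
      (Eventually.of_forall fun ξ => (measurePreserving_sub_right volume (b * ξ)).map_eq)
  have h1 : Integrable (fun p : ℝ × ℝ => W p.1 • G (p.2 - b * p.1)) (volume.prod volume) :=
    hmp.integrable_comp_of_integrable (hW.integrable.smul_prod hGi)
  rw [Measure.prod_restrict]
  refine IntegrableOn.congr_fun h1.integrableOn ?_ (measurableSet_Ioc.prod measurableSet_Ioc)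
  rintro ⟨ξ, θ⟩ ⟨h2, h3⟩
  simp only [mem_Ioc] at h2 h3
  have h4 : θ - b * ξ ∈ Icc (-c) c := by
    have h5 : b * ξ ≤ b * π := by gcongr; exact h2.2
    have h6 : b * (-π) ≤ b * ξ := by gcongr; exact h2.1.le
    constructor <;> linarith [h3.1, h3.2]
  simp only [hG, indicator_of_mem h4]

theorem IsWeightFunction.intervalIntegrable_smoothing (hW : IsWeightFunction W)
    (hF : Function.Periodic F (2 * π)) (hi : IntervalIntegrable F volume (-π) π) {b : ℝ}
    (hb : 0 < b) :
    IntervalIntegrable (fun θ => ∫ ξ in (-π)..π, W ξ • F (θ - b * ξ)) volume (-π) π := by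
  have hpi : -π ≤ π := by linarith [Real.pi_pos]
  rw [intervalIntegrable_iff_integrableOn_Ioc_of_le hpi]
  simp only [intervalIntegral.integral_of_le hpi]
  exact (hW.integrable_uncurry_smul hF hi hb).integral_prod_right

/-- After Fubini, the inner integral runs over a shifted full period and does not depend on `ξ`;
what remains is `∫ W = 1`. -/
theorem IsWeightFunction.integral_smoothing [CompleteSpace E] (hW : IsWeightFunction W)
    (hF : Function.Periodic F (2 * π)) (hi : IntervalIntegrable F volume (-π) π) {b : ℝ}
    (hb : 0 < b) :
    ∫ θ in (-π)..π, ∫ ξ in (-π)..π, W ξ • F (θ - b * ξ) = ∫ θ in (-π)..π, F θ := by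
  have hpi : -π ≤ π := by linarith [Real.pi_pos]
  have h1 : ∫ θ in (-π)..π, ∫ ξ in (-π)..π, W ξ • F (θ - b * ξ)
      = ∫ ξ in (-π)..π, ∫ θ in (-π)..π, W ξ • F (θ - b * ξ) := by
    simp only [intervalIntegral.integral_of_le hpi]
    exact (integral_integral_swap (f := fun ξ θ => W ξ • F (θ - b * ξ))
      (hW.integrable_uncurry_smul hF hi hb)).symm
  have h2 : ∀ ξ, ∫ θ in (-π)..π, F (θ - b * ξ) = ∫ θ in (-π)..π, F θ := by
    intro ξ
    rw [intervalIntegral.integral_comp_sub_right F]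
    have := hF.intervalIntegral_add_eq (-π - b * ξ) (-π)
    rwa [show -π - b * ξ + 2 * π = π - b * ξ by ring, show -π + 2 * π = π by ring] at this
  rw [h1]
  simp only [intervalIntegral.integral_smul, h2, intervalIntegral.integral_smul_const,
    hW.intervalIntegral_eq_one, one_smul]

end Smoothing

/-! ### The integrated bias -/

section Bias

variable {M Ω : Type*} [MeasurableSpace M] [MeasurableSpace Ω] {ν : Measure M} [SFinite ν]
  {P : Measure Ω} [IsProbabilityMeasure P] {X : ℤ → Ω → Lp ℝ 2 ν} {R : ℤ → HS ν} {F : ℝ → HS ν}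
  {W : ℝ → ℝ} {b : ℝ}

theorem integral_weightedPeriodogram_sub (hX : ∀ t, MemLp (X t) 2 P) (T : ℕ) (θ : ℝ) :
    ∫ w, (weightedPeriodogram X W b T θ w - smoothedDensity F W b θ) ∂P =
      (∫ w, weightedPeriodogram X W b T θ w ∂P) - smoothedDensity F W b θ := by
  rw [integral_sub (integrable_weightedPeriodogram hX W b T θ) (integrable_const _),
    integral_const]
  simp

omit [IsProbabilityMeasure P] in
theorem intervalIntegrable_mean_weightedPeriodogram (hX : ∀ t, MemLp (X t) 2 P)
    (hW : IsWeightFunction W) (hb : 0 < b) (T : ℕ) :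
    IntervalIntegrable (fun θ => ∫ w, weightedPeriodogram X W b T θ w ∂P) volume (-π) π ∧
      ∫ θ in (-π)..π, ∫ w, weightedPeriodogram X W b T θ w ∂P =
        (2 * π / T : ℝ) • ∑ s ∈ Finset.Icc 1 (T - 1),
          ∫ w, periodogram X T (2 * π * s / T) w ∂P := by
  simp only [integral_weightedPeriodogram hX]
  have h1 : ∀ s : ℕ, IntervalIntegrable (fun θ => periodizedWeight W b (θ - 2 * π * s / T) •
      ∫ w, periodogram X T (2 * π * s / T) w ∂P) volume (-π) π := fun s =>
    intervalIntegrable_iff.2 ((intervalIntegrable_iff.1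
      (hW.intervalIntegrable_periodizedWeight hb (2 * π * s / T)).1).smul_const _)
  have h2 : IntervalIntegrable (fun θ => ∑ s ∈ Finset.Icc 1 (T - 1),
      periodizedWeight W b (θ - 2 * π * s / T) •
        ∫ w, periodogram X T (2 * π * s / T) w ∂P) volume (-π) π := by
    simpa only [Finset.sum_fn] using IntervalIntegrable.sum _ fun s _ => h1 s
  refine ⟨h2.smul (2 * π / T : ℝ), ?_⟩
  rw [intervalIntegral.integral_smul, intervalIntegral.integral_finsetSum fun s _ => h1 s]
  simp only [intervalIntegral.integral_smul_const,
    (hW.intervalIntegrable_periodizedWeight hb _).2, one_smul]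

theorem intervalIntegrable_bias (hX : ∀ t, MemLp (X t) 2 P) (hF : IsSpectralDensity R F)
    (hW : IsWeightFunction W) (hb : 0 < b) (T : ℕ) :
    IntervalIntegrable
      (fun θ => ∫ w, (weightedPeriodogram X W b T θ w - smoothedDensity F W b θ) ∂P)
      volume (-π) π := by
  simp only [integral_weightedPeriodogram_sub hX]
  exact (intervalIntegrable_mean_weightedPeriodogram hX hW hb T).1.sub
    (hW.intervalIntegrable_smoothing hF.periodic hF.integrable hb)

/-- The integrated bias is minus the contribution of the omitted zero frequency. -/
theorem integral_bias (hX : IsStationarySeries P X R) (hF : IsSpectralDensity R F)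
    (hW : IsWeightFunction W) (hb : 0 < b) {T : ℕ} (hT : 0 < T) :
    ∫ θ in (-π)..π, ∫ w, (weightedPeriodogram X W b T θ w - smoothedDensity F W b θ) ∂P =
      -((2 * π / T : ℝ) • ∫ w, periodogram X T 0 w ∂P) := by
  obtain ⟨h1, h2⟩ := intervalIntegrable_mean_weightedPeriodogram (P := P) hX.memLp hW hb T
  have h3 : IntervalIntegrable (smoothedDensity F W b) volume (-π) π :=
    hW.intervalIntegrable_smoothing hF.periodic hF.integrable hb
  have h4 : ∫ θ in (-π)..π, smoothedDensity F W b θ = R 0 := by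
    rw [hF.fourier 0]
    simpa [smoothedDensity] using hW.integral_smoothing hF.periodic hF.integrable hb
  -- The estimator sums from `s = 1`, whereas the exact identity for `R 0` includes `s = 0`; this
  -- one frequency is the whole discrepancy.
  have h5 : Finset.range T = insert 0 (Finset.Icc 1 (T - 1)) := by
    ext s; simp; omega
  have h6 := sum_integral_periodogram hX hT
  rw [h5, Finset.sum_insert (by simp), smul_add] at h6
  simp only [integral_weightedPeriodogram_sub hX.memLp]
  rw [intervalIntegral.integral_sub h1 h3, h2, h4, ← h6]
  simp

/-- At frequency zero all phases are one, so the double-sum estimate applies directly: `(2π/T) ·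
(2πT)⁻¹ · T^{3/2} = T^{-1/2}`. -/
theorem norm_integral_bias_le (hX : IsStationarySeries P X R) (hF : IsSpectralDensity R F)
    (hF2 : IntervalIntegrable (fun θ => ‖F θ‖ ^ 2) volume (-π) π)
    (hW : IsWeightFunction W) (hb : 0 < b) {T : ℕ} (hT : 0 < T) :
    ‖∫ θ in (-π)..π, ∫ w, (weightedPeriodogram X W b T θ w - smoothedDensity F W b θ) ∂P‖ ≤
      (2 * π + ∫ θ in (-π)..π, ‖F θ‖ ^ 2) / 2 * (T : ℝ) ^ (-(1 / 2) : ℝ) := by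
  have hT' : (0 : ℝ) < T := by exact_mod_cast hT
  have hpi := Real.pi_pos
  have h1 := norm_sum_fourierCoeff_le hF.integrable hF.fourier hF2 T
  rw [integral_bias hX hF hW hb hT, norm_neg, norm_smul, integral_periodogram hX, norm_smul]
  simp only [Complex.ofReal_zero, mul_zero, zero_mul, Complex.exp_zero, one_smul]
  rw [Complex.norm_real, Real.norm_of_nonneg (by positivity), Real.norm_of_nonneg (by positivity)]
  calc _ ≤ 2 * π / T * ((2 * π * T)⁻¹ *
        (T * (√T * ((2 * π + ∫ θ in (-π)..π, ‖F θ‖ ^ 2) / 2)))) := by gcongr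
    _ = _ := by
      rw [Real.rpow_neg hT'.le, ← Real.sqrt_eq_rpow]
      have h2 : (√T)⁻¹ = √T / T := by
        rw [eq_div_iff hT'.ne', inv_mul_eq_div, Real.div_sqrt]
      rw [h2]
      field_simp

end Bias

end ManifoldFTS

theorem corollary4p1
    -- the manifold, its normalized Riemannian measure and the Laplace–Beltrami eigenbasis
    {d : ℕ} {M : Type*} [MetricSpace M] [CompactSpace M] [ConnectedSpace M]
    [ChartedSpace (EuclideanSpace ℝ (Fin d)) M] [IsManifold (𝓡 d) ∞ M]
    [RiemannianBundle (fun x : M => TangentSpace (𝓡 d) x)]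
    [IsContMDiffRiemannianBundle (𝓡 d) ∞ (EuclideanSpace ℝ (Fin d))
      (fun x : M => TangentSpace (𝓡 d) x)]
    [IsRiemannianManifold (𝓡 d) M] (hM : IsTwoPointHomogeneous M)
    [MeasurableSpace M] [BorelSpace M]
    (ν : Measure M) [IsProbabilityMeasure ν] (hν : IsRiemannianMeasure d ν)
    {Γ : ℕ → ℕ} (S : HilbertBasis (Σ n : ℕ, Fin (Γ n)) ℂ (Lp ℂ 2 ν)) (lam : ℕ → ℝ)
    (hS : IsLaplaceEigenbasis d S lam)
    -- the stationary series and its spectral density operator family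
    {Ω : Type*} [MeasurableSpace Ω] (P : Measure Ω) [IsProbabilityMeasure P]
    (X : ℤ → Ω → Lp ℝ 2 ν) (R : ℤ → HS ν) (hX : IsStationarySeries P X R)
    (F : ℝ → HS ν) (hF : IsSpectralDensity R F)
    -- the long-range dependence alternative
    (Mop : ℝ → HS ν) (m : ℕ → ℝ → ℝ) (α : ℕ → ℝ) (l L : ℝ)
    (hLRD : IsLRDAlternative S F Mop m α l L)
    -- the fourth-order cumulant assumption and the condition on the regular part
    (hcum : FourthOrderAssumption P X)
    (hreg : ∫⁻ θ in Icc (-π) π,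
      nuclearNorm (Mop θ) ^ 2 * ENNReal.ofReal (|θ| ^ (-2 * L)) ≠ ⊤)
    -- the weight function and the bandwidth
    (W : ℝ → ℝ) (hW : IsWeightFunction W)
    (B : ℕ → ℝ) (hBpos : ∀ T, 0 < B T) (hB0 : Tendsto B atTop (𝓝 0))
    (hBT : Tendsto (fun T : ℕ => B T * T) atTop atTop) :
    -- the integrals in the claim exist
    (∀ T : ℕ, 2 ≤ T →
      (∀ θ, Integrable (fun w => weightedPeriodogram X W (B T) T θ w) P) ∧
      (∀ θ, IntervalIntegrable (fun ξ => W ξ • F (θ - B T * ξ)) volume (-π) π) ∧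
      IntervalIntegrable
        (fun θ => ∫ w, (weightedPeriodogram X W (B T) T θ w - smoothedDensity F W (B T) θ) ∂P)
        volume (-π) π) ∧
    -- the rate
    (fun T : ℕ => ‖∫ θ in (-π)..π, ∫ w,
        (weightedPeriodogram X W (B T) T θ w - smoothedDensity F W (B T) θ) ∂P‖)
      =O[atTop] (fun T : ℕ => (T : ℝ) ^ (-(1 / 2) : ℝ) * B T ^ (-(1 / 2) : ℝ)) := by
  refine ⟨fun T _ => ⟨integrable_weightedPeriodogram hX.memLp W (B T) T,
    hW.intervalIntegrable_smul hF.periodic hF.integrable (hBpos T),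
    intervalIntegrable_bias hX.memLp hF hW (hBpos T) T⟩, ?_⟩
  have hF2 := hLRD.intervalIntegrable_sq_norm hF hreg
  refine Asymptotics.IsBigO.of_bound ((2 * π + ∫ θ in (-π)..π, ‖F θ‖ ^ 2) / 2) ?_
  filter_upwards [eventually_gt_atTop 0, hB0.eventually_lt_const one_pos] with T hT hB1
  -- The bandwidth enters the rate only here: the bias is already `O(T^{-1/2})`, and the extra
  -- factor is at least one for small bandwidth.
  have h1 : 1 ≤ B T ^ (-(1 / 2) : ℝ) :=
    Real.one_le_rpow_of_pos_of_le_one_of_nonpos (hBpos T) hB1.le (by norm_num)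
  have h2 : 0 ≤ ∫ θ in (-π)..π, ‖F θ‖ ^ 2 :=
    intervalIntegral.integral_nonneg (by linarith [Real.pi_pos]) fun _ _ => by positivity
  have h3 : (0 : ℝ) ≤ (T : ℝ) ^ (-(1 / 2) : ℝ) := by positivity
  rw [norm_norm, Real.norm_of_nonneg (mul_nonneg h3 (zero_le_one.trans h1))]
  refine (norm_integral_bias_le hX hF hF2 hW (hBpos T) hT).trans ?_
  exact mul_le_mul_of_nonneg_left (le_mul_of_one_le_right h3 h1) (by positivity)
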